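/- Let $H$ be an infinite-dimensional real or complex Hilbert space, let $F(H)$ be the space of finite-rank bounded operators on $H$, and fix an isometric isomorphism $J$ from the Hilbertian tensor product $H\otimes H$ (the completion of the algebraic tensor product) onto $H$; for $A,B\in F(H)$ regard $A\otimes B$ as the element $J(A\otimes B)J^{-1}$ of $F(H)$. Let $\|\cdot\|$ be a norm on $F(H)$ which is unitarily invariant, i.e. $\|UAV\|=\|A\|$ for all $A\in F(H)$ and all unitary operators $U,V$ on $H$, and multiplicative, i.e. $\|A\otimes B\|=\|A\|\cdot\|B\|$ for all $A,B\in F(H)$. Then there exists $p\in[1,\infty]$ such that $\|A\|=\|A\|_p$ for every $A\in F(H)$, where $\|\cdot\|_p$ is the Schatten $p$-norm: $\|A\|_p=(\operatorname{Tr}|A|^p)^{1/p}$ with $|A|=(A^*A)^{1/2}$ if $p<\infty$, and $\|A\|_\infty$ is the operator norm. -/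

import Mathlib

open scoped TensorProduct ENNReal InnerProduct

namespace SchattenChar

noncomputable section

/-- The space `F(H)` of finite-rank operators: bounded linear operators on `H` with
finite-dimensional range. -/
def FiniteRank (𝕜 : Type*) [RCLike 𝕜] (H : Type*) [NormedAddCommGroup H]
    [InnerProductSpace 𝕜 H] : Submodule 𝕜 (H →L[𝕜] H) where
  carrier := {A | FiniteDimensional 𝕜 A.toLinearMap.range}
  zero_mem' := by
    change FiniteDimensional 𝕜 (LinearMap.range (0 : H →ₗ[𝕜] H))
    rw [LinearMap.range_zero]
    infer_instance
  add_mem' := by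
    intro A B hA hB
    have hA' : FiniteDimensional 𝕜 A.toLinearMap.range := hA
    have hB' : FiniteDimensional 𝕜 B.toLinearMap.range := hB
    have h : (A + B).toLinearMap.range ≤ A.toLinearMap.range ⊔ B.toLinearMap.range := by
      rintro _ ⟨x, rfl⟩
      exact Submodule.add_mem_sup ⟨x, rfl⟩ ⟨x, rfl⟩
    exact Submodule.finiteDimensional_of_le h
  smul_mem' := by
    intro c A hA
    have hA' : FiniteDimensional 𝕜 A.toLinearMap.range := hA
    have h : (c • A).toLinearMap.range ≤ A.toLinearMap.range := by
      rintro _ ⟨x, rfl⟩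
      exact ⟨c • x, by simp⟩
    exact Submodule.finiteDimensional_of_le h

section

variable {𝕜 : Type*} [RCLike 𝕜] {H : Type*} [NormedAddCommGroup H] [InnerProductSpace 𝕜 H]

/-- The operator `U A V`, for `A` of finite rank and `U`, `V` unitary operators on `H`. -/
def unitaryMul (U : H ≃ₗᵢ[𝕜] H) (A : FiniteRank 𝕜 H) (V : H ≃ₗᵢ[𝕜] H) : FiniteRank 𝕜 H :=
  ⟨(U.toContinuousLinearEquiv : H →L[𝕜] H) ∘L (A : H →L[𝕜] H) ∘L
      (V.toContinuousLinearEquiv : H →L[𝕜] H), by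
    have hA : FiniteDimensional 𝕜 (A : H →L[𝕜] H).toLinearMap.range := A.2
    have h : ((U.toContinuousLinearEquiv : H →L[𝕜] H) ∘L (A : H →L[𝕜] H) ∘L
        (V.toContinuousLinearEquiv : H →L[𝕜] H)).toLinearMap.range ≤
        (A : H →L[𝕜] H).toLinearMap.range.map
          (U.toContinuousLinearEquiv : H →L[𝕜] H).toLinearMap := by
      rintro _ ⟨x, rfl⟩
      exact ⟨_, ⟨V x, rfl⟩, rfl⟩
    exact Submodule.finiteDimensional_of_le h⟩

/-- The Hilbertian tensor product `H ⊗ H`: the completion of the algebraic tensor product for the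
inner product with `⟪a ⊗ b, c ⊗ d⟫ = ⟪a, c⟫ ⟪b, d⟫`. -/
abbrev HilbertTensor (𝕜 : Type*) [RCLike 𝕜] (H : Type*) [NormedAddCommGroup H]
    [InnerProductSpace 𝕜 H] : Type _ :=
  UniformSpace.Completion (H ⊗[𝕜] H)

/-- The tensor product of two bounded operators, as a bounded operator on the Hilbertian tensor
product: the continuous extension of `x ⊗ y ↦ A x ⊗ B y`. -/
def tensorOp (A B : H →L[𝕜] H) : HilbertTensor 𝕜 H →L[𝕜] HilbertTensor 𝕜 H :=
  (TensorProduct.mapL A B).completion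

/-- `A ⊗ B` as a finite-rank operator on `H`, through an isometric isomorphism
`J : H ⊗ H ≃ H`. -/
def tensor (J : HilbertTensor 𝕜 H ≃ₗᵢ[𝕜] H) (A B : FiniteRank 𝕜 H) : FiniteRank 𝕜 H :=
  ⟨(J.toContinuousLinearEquiv : HilbertTensor 𝕜 H →L[𝕜] H) ∘L
      tensorOp (A : H →L[𝕜] H) (B : H →L[𝕜] H) ∘L
      (J.symm.toContinuousLinearEquiv : H →L[𝕜] HilbertTensor 𝕜 H), by
    have hA : FiniteDimensional 𝕜 (A : H →L[𝕜] H).toLinearMap.range := A.2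
    have hB : FiniteDimensional 𝕜 (B : H →L[𝕜] H).toLinearMap.range := B.2
    let W : Submodule 𝕜 (H ⊗[𝕜] H) := LinearMap.range (TensorProduct.mapIncl
      (A : H →L[𝕜] H).toLinearMap.range (B : H →L[𝕜] H).toLinearMap.range)
    let W' : Submodule 𝕜 (HilbertTensor 𝕜 H) :=
      W.map (UniformSpace.Completion.toComplL (𝕜 := 𝕜) (E := H ⊗[𝕜] H)).toLinearMap
    have hW : ∀ z : H ⊗[𝕜] H,
        TensorProduct.map (A : H →L[𝕜] H).toLinearMap (B : H →L[𝕜] H).toLinearMap z ∈ W := by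
      intro z
      induction z using TensorProduct.induction_on with
      | zero => simp
      | tmul x y => exact ⟨⟨A.1 x, x, rfl⟩ ⊗ₜ ⟨B.1 y, y, rfl⟩, rfl⟩
      | add x y hx hy => rw [map_add]; exact W.add_mem hx hy
    have hclosed : IsClosed (W' : Set (HilbertTensor 𝕜 H)) := W'.closed_of_finiteDimensional
    have hT : ∀ z : HilbertTensor 𝕜 H,
        tensorOp (A : H →L[𝕜] H) (B : H →L[𝕜] H) z ∈ W' := by
      intro z
      induction z using UniformSpace.Completion.induction_on with
      | hp => exact hclosed.preimage (tensorOp (A : H →L[𝕜] H) (B : H →L[𝕜] H)).continuous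
      | ih z =>
        refine ⟨_, hW z, ?_⟩
        rw [tensorOp, ContinuousLinearMap.completion_apply_coe, ← TensorProduct.toLinearMap_mapL]
        rfl
    have h : ((J.toContinuousLinearEquiv : HilbertTensor 𝕜 H →L[𝕜] H) ∘L
        tensorOp (A : H →L[𝕜] H) (B : H →L[𝕜] H) ∘L
        (J.symm.toContinuousLinearEquiv : H →L[𝕜] HilbertTensor 𝕜 H)).toLinearMap.range ≤
        W'.map (J.toContinuousLinearEquiv : HilbertTensor 𝕜 H →L[𝕜] H).toLinearMap := by
      rintro _ ⟨x, rfl⟩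
      exact ⟨_, hT (J.symm x), rfl⟩
    exact Submodule.finiteDimensional_of_le h⟩

/-- The trace of a finite-rank operator, i.e. the trace of its restriction to its
(finite-dimensional) range. -/
def opTrace (T : H →L[𝕜] H) : 𝕜 :=
  LinearMap.trace 𝕜 T.toLinearMap.range
    (T.toLinearMap.restrict fun x _ => LinearMap.mem_range_self T.toLinearMap x)

/-- The spectral projection of `|A| = (A* A)^{1/2}` at the point `s > 0`: the orthogonal projection
onto the eigenspace of `A* A` for the eigenvalue `s ^ 2`. -/
def absSpectralProj [CompleteSpace H] (A : H →L[𝕜] H) (s : ℝ) : H →L[𝕜] H :=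
  ((A† ∘L A) - ((s ^ 2 : ℝ) : 𝕜) • ContinuousLinearMap.id 𝕜 H).ker.starProjection

/-- The operator `|A|^p`, for `A` of finite rank and `p > 0`, through the spectral decomposition
`|A|^p = ∑ s^p P_s`, where `s` ranges over the (finitely many) positive eigenvalues of `|A|` and
`P_s` is the spectral projection of `|A|` at `s`. -/
def absPow [CompleteSpace H] (A : H →L[𝕜] H) (p : ℝ) : H →L[𝕜] H :=
  ∑ᶠ s ∈ Set.Ioi (0 : ℝ), ((s ^ p : ℝ) : 𝕜) • absSpectralProj A s

/-- The Schatten `p`-norm of a finite-rank operator: `(Tr |A|^p)^{1/p}` for `p < ∞`, the operator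
norm for `p = ∞`. -/
def schattenNorm [CompleteSpace H] (p : ℝ≥0∞) (A : H →L[𝕜] H) : ℝ :=
  if p = ∞ then ‖A‖
  else (RCLike.re (opTrace (absPow A p.toReal))) ^ (1 / p.toReal)

end

end

end SchattenChar

/-! The singular value decomposition and unitary invariance show that the norm of an operator
depends only on its singular values. The norm is thus a symmetric gauge `φ` on finite real vectors,
and multiplicativity on operators becomes `φ (a ⊗ b) = φ a * φ b` (`isCrossGauge_gauge`).

On the all-ones vector of length `n` the gauge is monotone and multiplicative in `n`, hence equal to
`n ^ α`; the triangle inequality gives `α ≤ 1` (`exists_exponent`). The exponent sought is `p = 1 /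
α`, with `p = ∞` when `α = 0`.

For a positive vector `a` with `k` entries, the power `a^{⊗n}` has `k ^ n` entries but at most `(n +
1) ^ k` distinct values (`card_image_prod_le`). The gauge of a vector is at least its largest
level-set contribution `v * m ^ α` (value `v`, multiplicity `m`), and at most that contribution
times the number of values. The `ℓ^p` norm obeys the same two bounds, so the `n`-th powers of `φ a`
and of the `ℓ^p` norm of `a` differ by at most a polynomial factor in `n`, which disappears on
taking `n`-th roots (`eq_of_level`). -/

namespace SchattenChar

/-! ### Growth estimates and counting -/

/-- If `x ^ n ≤ C (n + 1) ^ d y ^ n` for all `n`, then `x ≤ y`. -/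
theorem le_of_pow_le_polynomial_mul_pow {x y C : ℝ} (d : ℕ) (hy : 0 ≤ y)
    (h : ∀ n : ℕ, x ^ n ≤ C * ((n : ℝ) + 1) ^ d * y ^ n) : x ≤ y := by
  by_contra! hlt
  rcases hy.eq_or_lt with rfl | hy
  · have := h 1
    simp at this
    linarith
  have hr : 1 < x / y := (one_lt_div hy).2 hlt
  have hlim := tendsto_pow_const_div_const_pow_of_one_lt d hr
  -- The shift turns `n ^ d` into `(n + 1) ^ d`; the factor `x / y` in the constant then compensates
  -- for the shifted exponent of the denominator.
  have hlim1 := (Filter.tendsto_add_atTop_iff_nat 1).2 hlim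
  have hlim2 := hlim1.const_mul (C * (x / y))
  rw [mul_zero] at hlim2
  have hle : ∀ n : ℕ, (1 : ℝ) ≤ C * (x / y) * (((n + 1 : ℕ) : ℝ) ^ d / (x / y) ^ (n + 1)) := by
    intro n
    have hpos : (0 : ℝ) < (x / y) ^ n := pow_pos (by linarith) n
    have h1 : (x / y) ^ n ≤ C * ((n : ℝ) + 1) ^ d := by
      rw [div_pow, div_le_iff₀ (pow_pos hy n)]
      exact h n
    have h2 : C * (x / y) * (((n + 1 : ℕ) : ℝ) ^ d / (x / y) ^ (n + 1)) =
        C * ((n : ℝ) + 1) ^ d / (x / y) ^ n := by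
      have : x ≠ 0 := by linarith
      rw [pow_succ]
      push_cast
      field_simp
    rw [h2, le_div_iff₀ hpos, one_mul]
    exact h1
  have := ge_of_tendsto' hlim2 hle
  linarith

/-- A monotone multiplicative function on the positive integers is a power function. -/
theorem eq_rpow_of_monotone_of_mul {f : ℕ → ℝ} (hmono : Monotone f) (h1 : f 1 = 1)
    (hmul : ∀ m n, f (m * n) = f m * f n) {n : ℕ} (hn : n ≠ 0) :
    f n = (n : ℝ) ^ (Real.logb 2 (f 2)) := by
  set α := Real.logb 2 (f 2) with hα
  have hpos : ∀ m : ℕ, m ≠ 0 → 1 ≤ f m := fun m hm => h1 ▸ hmono (Nat.one_le_iff_ne_zero.2 hm)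
  have hpow : ∀ m k : ℕ, f (m ^ k) = f m ^ k := by
    intro m k
    induction k with
    | zero => simp [h1]
    | succ k ih => rw [pow_succ, hmul, ih, pow_succ]
  have hα0 : 0 ≤ α := Real.logb_nonneg (by norm_num) (hpos 2 (by norm_num))
  have h2 : f 2 = (2 : ℝ) ^ α := by
    rw [hα, Real.rpow_logb (by norm_num) (by norm_num)]
    linarith [hpos 2 (by norm_num)]
  have h2pow : ∀ j : ℕ, f (2 ^ j) = ((2 : ℝ) ^ j) ^ α := by
    intro j
    rw [hpow, h2, ← Real.rpow_natCast, ← Real.rpow_mul (by norm_num), mul_comm,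
      Real.rpow_mul (by norm_num), Real.rpow_natCast]
  have hnk : ∀ k : ℕ, ((n : ℝ) ^ α) ^ k = ((n : ℝ) ^ k) ^ α := by
    intro k
    rw [← Real.rpow_natCast, ← Real.rpow_mul (by positivity), mul_comm,
      Real.rpow_mul (by positivity), Real.rpow_natCast]
  have hlow : ∀ k : ℕ, (2 : ℝ) ^ (Nat.log 2 (n ^ k)) ≤ (n : ℝ) ^ k := by
    intro k
    exact_mod_cast Nat.pow_log_le_self 2 (pow_ne_zero k hn)
  have hup : ∀ k : ℕ, (n : ℝ) ^ k ≤ (2 : ℝ) ^ (Nat.log 2 (n ^ k) + 1) := by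
    intro k
    exact_mod_cast (Nat.lt_pow_succ_log_self (b := 2) (by norm_num) (n ^ k)).le
  apply le_antisymm
  -- Since `n ^ k` lies between consecutive powers of two, where `f` is known, the error is at most
  -- one factor `f 2 = 2 ^ α`, uniformly in `k`.
  · refine le_of_pow_le_polynomial_mul_pow (C := (2 : ℝ) ^ α) 0 (by positivity) fun k => ?_
    rw [pow_zero, mul_one, hnk, ← hpow, ← Real.mul_rpow (by norm_num) (by positivity)]
    refine (hmono (Nat.lt_pow_succ_log_self (b := 2) (by norm_num) (n ^ k)).le).trans ?_
    rw [h2pow]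
    refine Real.rpow_le_rpow (by positivity) ?_ hα0
    rw [pow_succ, mul_comm]
    exact mul_le_mul_of_nonneg_left (hlow k) (by norm_num)
  · refine le_of_pow_le_polynomial_mul_pow (C := (2 : ℝ) ^ α) 0
      (zero_le_one.trans (hpos n hn)) fun k => ?_
    rw [pow_zero, mul_one, hnk, ← hpow]
    refine (Real.rpow_le_rpow (by positivity) (hup k) hα0).trans ?_
    rw [pow_succ, mul_comm, Real.mul_rpow (by norm_num) (by positivity), ← h2pow]
    exact mul_le_mul_of_nonneg_left (hmono (Nat.pow_log_le_self 2 (pow_ne_zero k hn)))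
      (by positivity)

/-- The entries of the `n`-th tensor power of a vector with `k` entries take at most
`(n + 1) ^ k` values. -/
theorem card_image_prod_le {ι : Type} [Fintype ι] (a : ι → ℝ) (n : ℕ) :
    ((Finset.univ : Finset (Fin n → ι)).image fun x => ∏ j, a (x j)).card ≤
      (n + 1) ^ Fintype.card ι := by
  classical
  -- The product depends only on how often each index occurs in the word `x`, a number between `0`
  -- and `n`.
  let t : (Fin n → ι) → ι → Fin (n + 1) := fun x i =>
    ⟨(Finset.univ.filter fun j => x j = i).card,
      Nat.lt_succ_of_le ((Finset.card_le_univ _).trans (by simp))⟩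
  let g : (ι → Fin (n + 1)) → ℝ := fun s => ∏ i, a i ^ (s i : ℕ)
  have hg : (fun x : Fin n → ι => ∏ j, a (x j)) = g ∘ t := by
    funext x
    simp only [g, t, Function.comp]
    rw [← Finset.prod_fiberwise_of_maps_to (s := Finset.univ) (t := Finset.univ) (g := x)
      (fun _ _ => Finset.mem_univ _)]
    refine Finset.prod_congr rfl fun i _ => ?_
    rw [Finset.prod_congr rfl (g := fun _ => a i), Finset.prod_const]
    intro j hj
    rw [(Finset.mem_filter.1 hj).2]
  rw [hg, ← Finset.image_image]
  refine Finset.card_image_le.trans ((Finset.card_le_univ _).trans ?_)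
  simp

/-! ### Multiplicative symmetric gauges -/

/-- A norm on finitely supported real vectors which is invariant under reindexing, changes of sign
and extension by zero, and multiplicative for tensor products. -/
structure IsCrossGauge (φ : ∀ (ι : Type) [Fintype ι], (ι → ℝ) → ℝ) : Prop where
  add_le : ∀ {ι : Type} [Fintype ι] (a b : ι → ℝ), φ ι (a + b) ≤ φ ι a + φ ι b
  smul : ∀ {ι : Type} [Fintype ι] (c : ℝ) (a : ι → ℝ), φ ι (c • a) = |c| * φ ι a
  sign : ∀ {ι : Type} [Fintype ι] (ε a : ι → ℝ), (∀ i, ε i = 1 ∨ ε i = -1) → φ ι (ε * a) = φ ι a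
  embed : ∀ {ι κ : Type} [Fintype ι] [Fintype κ] (g : ι ↪ κ) (a : κ → ℝ),
    (∀ k, k ∉ Set.range g → a k = 0) → φ κ a = φ ι (a ∘ g)
  tensor : ∀ {ι κ : Type} [Fintype ι] [Fintype κ] (a : ι → ℝ) (b : κ → ℝ),
    φ (ι × κ) (fun x => a x.1 * b x.2) = φ ι a * φ κ b
  unit_ne_zero : φ Unit 1 ≠ 0

namespace IsCrossGauge

variable {φ : ∀ (ι : Type) [Fintype ι], (ι → ℝ) → ℝ} (h : IsCrossGauge φ)

include h

theorem map_zero {ι : Type} [Fintype ι] : φ ι 0 = 0 := by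
  simpa using h.smul (0 : ℝ) (0 : ι → ℝ)

theorem nonneg {ι : Type} [Fintype ι] (a : ι → ℝ) : 0 ≤ φ ι a := by
  have h1 := h.add_le a ((-1 : ℝ) • a)
  rw [h.smul] at h1
  simp [h.map_zero] at h1
  exact h1

theorem reindex {ι κ : Type} [Fintype ι] [Fintype κ] (e : ι ≃ κ) (a : κ → ℝ) :
    φ ι (a ∘ e) = φ κ a :=
  (h.embed e.toEmbedding a fun k hk => (hk ⟨e.symm k, by simp⟩).elim).symm

theorem sum_le {ι τ : Type} [Fintype ι] (s : Finset τ) (a : τ → ι → ℝ) :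
    φ ι (∑ j ∈ s, a j) ≤ ∑ j ∈ s, φ ι (a j) := by
  classical
  induction s using Finset.induction_on with
  | empty => simp [h.map_zero]
  | insert j s hj ih =>
    rw [Finset.sum_insert hj, Finset.sum_insert hj]
    exact (h.add_le _ _).trans (by linarith)

/-- The truncated vector is the average of `a` and of `a` with the signs flipped outside `p`, and
both have the same gauge. -/
theorem indicator_le {ι : Type} [Fintype ι] (p : ι → Prop) [DecidablePred p] (a : ι → ℝ) :
    φ ι (fun i => if p i then a i else 0) ≤ φ ι a := by
  let ε : ι → ℝ := fun i => if p i then 1 else -1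
  have hε : ∀ i, ε i = 1 ∨ ε i = -1 := fun i => by by_cases hi : p i <;> simp [ε, hi]
  have heq : (fun i => if p i then a i else 0) = (1 / 2 : ℝ) • (a + ε * a) := by
    funext i
    by_cases hi : p i <;> simp [ε, hi]
    ring
  rw [heq, h.smul, abs_of_pos (by norm_num)]
  have := h.add_le a (ε * a)
  rw [h.sign ε a hε] at this
  linarith

theorem indicator_const {ι : Type} [Fintype ι] (p : ι → Prop) [DecidablePred p] {c : ℝ}
    (hc : 0 ≤ c) : φ ι (fun i => if p i then c else 0) =
      c * φ (Fin (Finset.univ.filter p).card) 1 := by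
  have hcard : Fintype.card {i // p i} = (Finset.univ.filter p).card := Fintype.card_subtype p
  let e : Fin (Finset.univ.filter p).card ≃ {i // p i} := (Fintype.equivFinOfCardEq hcard).symm
  rw [h.embed (e.toEmbedding.trans (Function.Embedding.subtype p))]
  · have : ((fun i => if p i then c else 0) ∘ (e.toEmbedding.trans (Function.Embedding.subtype p)))
        = c • (1 : Fin (Finset.univ.filter p).card → ℝ) := by
      funext j
      simp [(e j).2]
    rw [this, h.smul, abs_of_nonneg hc]
  · intro i hi
    rw [if_neg]
    intro hpi
    exact hi ⟨e.symm ⟨i, hpi⟩, by simp⟩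

theorem count_mono : Monotone fun n : ℕ => φ (Fin n) 1 := by
  intro m n hmn
  have h1 := h.indicator_le (fun i : Fin n => (i : ℕ) < m) 1
  simp only [Pi.one_apply] at h1
  rw [h.indicator_const _ zero_le_one, one_mul] at h1
  have : (Finset.univ.filter fun i : Fin n => (i : ℕ) < m).card = m := by
    rw [Fin.card_filter_val_lt]
    exact min_eq_right hmn
  rwa [this] at h1

theorem count_mul (m n : ℕ) : φ (Fin (m * n)) 1 = φ (Fin m) 1 * φ (Fin n) 1 := by
  rw [← h.tensor, ← h.reindex (finProdFinEquiv (m := m) (n := n)) 1]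
  congr 1
  funext x
  simp

theorem count_one : φ (Fin 1) 1 = 1 := by
  have h0 : φ (Fin 1) 1 ≠ 0 := by
    rw [← h.reindex (Equiv.ofUnique Unit (Fin 1)) 1]
    exact h.unit_ne_zero
  have h1 := h.count_mul 1 1
  rw [mul_one] at h1
  exact (mul_right_cancel₀ h0 (by rw [one_mul]; exact h1)).symm

/-- Monotonicity and multiplicativity force a power law. The bound `α ≤ 1` is the triangle
inequality for the two basis vectors summing to `(1, 1)`. -/
theorem exists_exponent : ∃ α : ℝ, 0 ≤ α ∧ α ≤ 1 ∧
    ∀ n : ℕ, n ≠ 0 → φ (Fin n) 1 = (n : ℝ) ^ α := by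
  have h12 : (1 : ℝ) ≤ φ (Fin 2) 1 := h.count_one ▸ h.count_mono one_le_two
  refine ⟨Real.logb 2 (φ (Fin 2) 1), Real.logb_nonneg (by norm_num) h12, ?_, fun n hn =>
    eq_rpow_of_monotone_of_mul (f := fun n => φ (Fin n) 1) h.count_mono h.count_one h.count_mul hn⟩
  rw [Real.logb_le_iff_le_rpow (by norm_num) (by linarith), Real.rpow_one]
  have h2 := h.sum_le Finset.univ fun (j : Fin 2) (i : Fin 2) => if i = j then (1 : ℝ) else 0
  have h3 : ∀ j : Fin 2, φ (Fin 2) (fun i => if i = j then (1 : ℝ) else 0) = 1 := by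
    intro j
    rw [h.indicator_const _ zero_le_one, one_mul, Finset.filter_eq', if_pos (Finset.mem_univ j),
      Finset.card_singleton]
    exact h.count_one
  simp only [h3] at h2
  have h4 : (∑ j : Fin 2, fun i : Fin 2 => if i = j then (1 : ℝ) else 0) = 1 := by
    funext i
    simp [Finset.sum_apply]
  rw [h4] at h2
  simpa using h2

theorem map_tensorPow {ι : Type} [Fintype ι] (a : ι → ℝ) (n : ℕ) :
    φ (Fin n → ι) (fun x => ∏ j, a (x j)) = φ ι a ^ n := by
  induction n with
  | zero =>
    rw [pow_zero, ← h.count_one, ← h.reindex (Equiv.ofUnique (Fin 0 → ι) (Fin 1)) 1]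
    congr 1
  | succ n ih =>
    rw [pow_succ', ← ih, ← h.tensor, ← h.reindex (Fin.consEquiv fun _ : Fin (n + 1) => ι)]
    congr 1
    funext x
    simp [Fin.prod_univ_succ, Fin.consEquiv]

theorem level_le {α : ℝ} (hα : ∀ n : ℕ, n ≠ 0 → φ (Fin n) 1 = (n : ℝ) ^ α)
    {X : Type} [Fintype X] (b : X → ℝ) (hb : ∀ x, 0 < b x) (y : X) :
    b y * ((Finset.univ.filter fun x => b x = b y).card : ℝ) ^ α ≤ φ X b := by
  have h1 := h.indicator_le (fun x => b x = b y) b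
  have h2 : (fun x => if b x = b y then b x else 0) = fun x => if b x = b y then b y else 0 := by
    funext x
    split_ifs with hx
    · exact hx
    · rfl
  rw [h2, h.indicator_const _ (hb y).le, hα] at h1
  · exact h1
  · exact Finset.card_ne_zero_of_mem (a := y) (by simp)

/-- The vector is the sum, over its distinct values, of its restrictions to the level sets; each
term is a constant times an all-ones vector. -/
theorem le_of_level_le {α : ℝ} (hα : ∀ n : ℕ, n ≠ 0 → φ (Fin n) 1 = (n : ℝ) ^ α)
    {X : Type} [Fintype X] (b : X → ℝ) (hb : ∀ x, 0 < b x) {C : ℝ}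
    (hC : ∀ y, b y * ((Finset.univ.filter fun x => b x = b y).card : ℝ) ^ α ≤ C) :
    φ X b ≤ ((Finset.univ.image b).card : ℝ) * C := by
  classical
  have h1 : b = ∑ v ∈ Finset.univ.image b, fun x => if b x = v then v else 0 := by
    funext x
    rw [Finset.sum_apply, Finset.sum_ite_eq]
    simp
  conv_lhs => rw [h1]
  refine (h.sum_le _ _).trans ?_
  rw [← nsmul_eq_mul]
  refine Finset.sum_le_card_nsmul _ _ _ fun v hv => ?_
  obtain ⟨y, -, rfl⟩ := Finset.mem_image.1 hv
  rw [h.indicator_const _ (hb y).le, hα]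
  · exact hC y
  · exact Finset.card_ne_zero_of_mem (a := y) (by simp)

/-- Two functionals, multiplicative for tensor powers and comparable to the size of the level sets
up to the number of values, agree on positive vectors. -/
theorem eq_of_level {α : ℝ} (hα : ∀ n : ℕ, n ≠ 0 → φ (Fin n) 1 = (n : ℝ) ^ α)
    (L : ∀ (ι : Type) [Fintype ι], (ι → ℝ) → ℝ)
    (hL0 : ∀ (ι : Type) [Fintype ι] (a : ι → ℝ), (∀ i, 0 < a i) → 0 ≤ L ι a)
    (hLpow : ∀ (ι : Type) [Fintype ι] [Nonempty ι] (a : ι → ℝ), (∀ i, 0 < a i) → ∀ n : ℕ,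
      L (Fin n → ι) (fun x => ∏ j, a (x j)) = L ι a ^ n)
    (hL1 : ∀ (X : Type) [Fintype X] (b : X → ℝ), (∀ x, 0 < b x) → ∀ y,
      b y * ((Finset.univ.filter fun x => b x = b y).card : ℝ) ^ α ≤ L X b)
    (hL2 : ∀ (X : Type) [Fintype X] [Nonempty X] (b : X → ℝ), (∀ x, 0 < b x) → ∀ C : ℝ, 0 ≤ C →
      (∀ y, b y * ((Finset.univ.filter fun x => b x = b y).card : ℝ) ^ α ≤ C) →
      L X b ≤ ((Finset.univ.image b).card : ℝ) * C)
    {ι : Type} [Fintype ι] [Nonempty ι] (a : ι → ℝ) (ha : ∀ i, 0 < a i) : φ ι a = L ι a := by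
  have hb : ∀ n : ℕ, ∀ x : Fin n → ι, 0 < ∏ j, a (x j) := fun n x =>
    Finset.prod_pos fun j _ => ha _
  have hcard : ∀ n : ℕ, (((Finset.univ : Finset (Fin n → ι)).image
      fun x => ∏ j, a (x j)).card : ℝ) ≤ ((n : ℝ) + 1) ^ Fintype.card ι := fun n => by
    exact_mod_cast card_image_prod_le a n
  apply le_antisymm
  -- The upper bound for one functional, fed with the lower bound for the other, is applied to the
  -- `n`-th tensor power; the number of values costs `(n + 1) ^ card ι`.
  · refine le_of_pow_le_polynomial_mul_pow (C := 1) (Fintype.card ι) (hL0 ι a ha) fun n => ?_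
    rw [one_mul, ← h.map_tensorPow, ← hLpow ι a ha]
    refine (h.le_of_level_le hα _ (hb n) (hL1 _ _ (hb n))).trans ?_
    exact mul_le_mul_of_nonneg_right (hcard n) (hL0 _ _ (hb n))
  · refine le_of_pow_le_polynomial_mul_pow (C := 1) (Fintype.card ι) (h.nonneg a) fun n => ?_
    rw [one_mul, ← h.map_tensorPow, ← hLpow ι a ha]
    refine (hL2 _ _ (hb n) _ (h.nonneg _) (h.level_le hα _ (hb n))).trans ?_
    exact mul_le_mul_of_nonneg_right (hcard n) (h.nonneg _)

theorem eq_iSup (hα : ∀ n : ℕ, n ≠ 0 → φ (Fin n) 1 = 1)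
    {ι : Type} [Fintype ι] (a : ι → ℝ) (ha : ∀ i, 0 < a i) : φ ι a = ⨆ i, a i := by
  -- The empty vector represents the zero operator; the real supremum over an empty type is `0` by
  -- convention.
  rcases isEmpty_or_nonempty ι with hι | hι
  · rw [Subsingleton.elim a 0, h.map_zero, Real.iSup_of_isEmpty]
  refine h.eq_of_level (α := 0) (by simpa using hα) (fun ι _ a => ⨆ i, a i) ?_ ?_ ?_ ?_ a ha
  · exact fun ι _ a ha => Real.iSup_nonneg fun i => (ha i).le
  · intro ι _ _ a ha n
    obtain ⟨i, hi⟩ := Finite.exists_max a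
    have hsup : ⨆ i, a i = a i := le_antisymm (ciSup_le hi) (le_ciSup (Set.finite_range a).bddAbove i)
    rw [hsup]
    apply le_antisymm
    · refine ciSup_le fun x => ?_
      refine (Finset.prod_le_prod (fun j _ => (ha _).le) fun j _ => hi (x j)).trans ?_
      simp
    · refine le_trans ?_ (le_ciSup (Set.finite_range _).bddAbove fun _ : Fin n => i)
      simp
  · intro X _ b hb y
    simpa using le_ciSup (Set.finite_range b).bddAbove y
  · intro X _ _ b hb C hC0 hC
    simp only [Real.rpow_zero, mul_one] at hC
    refine (ciSup_le hC).trans (le_mul_of_one_le_left hC0 ?_)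
    exact_mod_cast Finset.card_pos.2 (Finset.univ_nonempty.image b)

theorem eq_rpow_sum {α : ℝ} (hα0 : 0 < α) (hα1 : α ≤ 1)
    (hα : ∀ n : ℕ, n ≠ 0 → φ (Fin n) 1 = (n : ℝ) ^ α)
    {ι : Type} [Fintype ι] (a : ι → ℝ) (ha : ∀ i, 0 < a i) :
    φ ι a = (∑ i, a i ^ α⁻¹) ^ α := by
  rcases isEmpty_or_nonempty ι with hι | hι
  · rw [Subsingleton.elim a 0, h.map_zero]
    simp [Real.zero_rpow hα0.ne']
  have hroot : ∀ x : ℝ, 0 ≤ x → (x ^ α⁻¹) ^ α = x := fun x hx => by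
    rw [← Real.rpow_mul hx, inv_mul_cancel₀ hα0.ne', Real.rpow_one]
  have hroot' : ∀ x : ℝ, 0 ≤ x → (x ^ α) ^ α⁻¹ = x := fun x hx => by
    rw [← Real.rpow_mul hx, mul_inv_cancel₀ hα0.ne', Real.rpow_one]
  refine h.eq_of_level hα (fun ι _ a => (∑ i, a i ^ α⁻¹) ^ α) ?_ ?_ ?_ ?_ a ha
  · exact fun ι _ a ha => Real.rpow_nonneg
      (Finset.sum_nonneg fun i _ => Real.rpow_nonneg (ha i).le _) _
  · intro ι _ _ a ha n
    have h0 : 0 ≤ ∑ i, a i ^ α⁻¹ := Finset.sum_nonneg fun i _ => Real.rpow_nonneg (ha i).le _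
    have h1 : ∑ x : Fin n → ι, (∏ j, a (x j)) ^ α⁻¹ = (∑ i, a i ^ α⁻¹) ^ n := by
      classical
      rw [← Fin.prod_const, Finset.prod_univ_sum, Fintype.piFinset_univ]
      exact Finset.sum_congr rfl fun x _ =>
        (Real.finsetProd_rpow _ _ (fun j _ => (ha _).le) _).symm
    rw [h1, ← Real.rpow_natCast, ← Real.rpow_mul h0, mul_comm, Real.rpow_mul h0, Real.rpow_natCast]
  · intro X _ b hb y
    -- With `b y` written as `(b y ^ α⁻¹) ^ α`, the claim says that one level set contributes at
    -- most the full sum.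
    rw [← hroot (b y) (hb y).le, ← Real.mul_rpow (Real.rpow_nonneg (hb y).le _) (Nat.cast_nonneg _),
      hroot (b y) (hb y).le]
    refine Real.rpow_le_rpow (mul_nonneg (Real.rpow_nonneg (hb y).le _) (Nat.cast_nonneg _)) ?_
      hα0.le
    rw [mul_comm, ← nsmul_eq_mul, ← Finset.sum_const]
    refine le_trans (Finset.sum_le_sum fun x hx => ?_)
      (Finset.sum_le_sum_of_subset_of_nonneg (Finset.filter_subset (fun x => b x = b y) _)
        fun x _ _ => Real.rpow_nonneg (hb x).le _)
    rw [(Finset.mem_filter.1 hx).2]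
  · intro X _ _ b hb C hC0 hC
    classical
    set M := (Finset.univ.image b).card with hM
    have hM1 : (1 : ℝ) ≤ M := by
      exact_mod_cast Finset.card_pos.2 (Finset.univ_nonempty.image b)
    have h1 : ∑ x, b x ^ α⁻¹ ≤ M * C ^ α⁻¹ := by
      rw [← Finset.sum_fiberwise_of_maps_to (s := Finset.univ) (t := Finset.univ.image b) (g := b)
        (fun x _ => Finset.mem_image_of_mem b (Finset.mem_univ x)), ← nsmul_eq_mul]
      refine Finset.sum_le_card_nsmul _ _ _ fun v hv => ?_
      obtain ⟨y, -, rfl⟩ := Finset.mem_image.1 hv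
      rw [Finset.sum_congr rfl (g := fun _ => b y ^ α⁻¹) fun x hx => by
        rw [(Finset.mem_filter.1 hx).2], Finset.sum_const, nsmul_eq_mul, mul_comm]
      have h2 := Real.rpow_le_rpow (mul_nonneg (hb y).le (Real.rpow_nonneg (Nat.cast_nonneg _) _))
        (hC y) (inv_nonneg.2 hα0.le)
      rwa [Real.mul_rpow (hb y).le (Real.rpow_nonneg (Nat.cast_nonneg _) _),
        hroot' _ (Nat.cast_nonneg _)] at h2
    refine (Real.rpow_le_rpow (Finset.sum_nonneg fun x _ => Real.rpow_nonneg (hb x).le _) h1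
      hα0.le).trans ?_
    rw [Real.mul_rpow (by positivity) (Real.rpow_nonneg hC0 _), hroot C hC0]
    refine mul_le_mul_of_nonneg_right ?_ hC0
    -- The sum bound yields the factor `M ^ α`; `α ≤ 1` and `M ≥ 1` reduce it to `M`.
    calc (M : ℝ) ^ α ≤ (M : ℝ) ^ (1 : ℝ) := Real.rpow_le_rpow_of_exponent_le hM1 hα1
      _ = M := Real.rpow_one _

end IsCrossGauge

/-! ### Unitary operators and diagonal operators -/

section

variable {𝕜 : Type*} [RCLike 𝕜] {H : Type*} [NormedAddCommGroup H] [InnerProductSpace 𝕜 H]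

theorem exists_orthonormal_nat (hH : ¬ FiniteDimensional 𝕜 H) :
    ∃ e : ℕ → H, Orthonormal 𝕜 e := by
  let b := Module.Free.chooseBasis 𝕜 H
  have hinf : Infinite (Module.Free.ChooseBasisIndex 𝕜 H) := by
    by_contra hfin
    rw [not_infinite_iff_finite] at hfin
    exact hH (Module.Finite.of_basis b)
  have hlin : LinearIndependent 𝕜 (b ∘ Infinite.natEmbedding _) :=
    b.linearIndependent.comp _ (Infinite.natEmbedding _).injective
  exact ⟨_, InnerProductSpace.gramSchmidtNormed_orthonormal hlin⟩

/-- A unitary operator of a finite-dimensional subspace, extended by the identity. -/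
theorem exists_unitary_extension (W : Submodule 𝕜 H) [FiniteDimensional 𝕜 W] (u : W ≃ₗᵢ[𝕜] W) :
    ∃ U : H ≃ₗᵢ[𝕜] H, ∀ w : W, U w = u w := by
  -- The extension is `u ⊕ id` on the orthogonal sum of `W` and `Wᗮ`.
  let m : WithLp 2 (W × Wᗮ) ≃ₗᵢ[𝕜] WithLp 2 (W × Wᗮ) :=
    { (WithLp.linearEquiv 2 𝕜 (W × Wᗮ)).trans
        ((u.toLinearEquiv.prodCongr (LinearEquiv.refl 𝕜 Wᗮ)).trans
          (WithLp.linearEquiv 2 𝕜 (W × Wᗮ)).symm) with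
      norm_map' := fun x => by
        rw [← sq_eq_sq₀ (norm_nonneg _) (norm_nonneg _), WithLp.prod_norm_sq_eq_of_L2,
          WithLp.prod_norm_sq_eq_of_L2]
        simp }
  refine ⟨(W.orthogonalDecomposition.trans m).trans W.orthogonalDecomposition.symm, fun w => ?_⟩
  have hw : W.orthogonalDecomposition (w : H) = WithLp.toLp 2 (w, 0) := by
    rw [Submodule.orthogonalDecomposition_apply]
    congr 1
    ext
    · simp
    · simp
  have hm : m (WithLp.toLp 2 (w, 0)) = WithLp.toLp 2 (u w, 0) := by
    simp [m]
  rw [LinearIsometryEquiv.trans_apply, LinearIsometryEquiv.trans_apply, hw, hm]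
  simp

theorem exists_orthonormalBasis_sum {W : Type*} [NormedAddCommGroup W] [InnerProductSpace 𝕜 W]
    [FiniteDimensional 𝕜 W] {ι κ : Type*} [Fintype ι] [Fintype κ]
    (hcard : Module.finrank 𝕜 W = Fintype.card ι + Fintype.card κ) {e : ι → W}
    (he : Orthonormal 𝕜 e) : ∃ b : OrthonormalBasis (ι ⊕ κ) 𝕜 W, ∀ i, b (Sum.inl i) = e i := by
  have hv : Orthonormal 𝕜 ((Set.range Sum.inl).domRestrict (Sum.elim e fun _ : κ => (0 : W))) := by
    have : (Set.range Sum.inl).domRestrict (Sum.elim e fun _ : κ => (0 : W)) =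
        e ∘ (Equiv.ofInjective (Sum.inl : ι → ι ⊕ κ) Sum.inl_injective).symm := by
      funext ⟨x, i, hi⟩
      subst hi
      simp [Set.domRestrict]
    rw [this]
    exact he.comp _ (Equiv.injective _)
  obtain ⟨b, hb⟩ := hv.exists_orthonormalBasis_extension_of_card_eq (by simpa using hcard)
  exact ⟨b, fun i => by simpa using hb (Sum.inl i) ⟨i, rfl⟩⟩

/-- Unitary operators act transitively on finite orthonormal families. -/
theorem exists_unitary_map_orthonormal {ι : Type*} [Fintype ι] {e e' : ι → H}
    (he : Orthonormal 𝕜 e) (he' : Orthonormal 𝕜 e') :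
    ∃ U : H ≃ₗᵢ[𝕜] H, ∀ i, U (e i) = e' i := by
  -- Inside one finite-dimensional space containing both families, each completes to an orthonormal
  -- basis with the same index type; matching the bases gives a unitary of `W`.
  let W : Submodule 𝕜 H := Submodule.span 𝕜 (Set.range e ∪ Set.range e')
  have hW : FiniteDimensional 𝕜 W :=
    FiniteDimensional.span_of_finite 𝕜 ((Set.finite_range e).union (Set.finite_range e'))
  let w : ι → W := fun i => ⟨e i, Submodule.subset_span (Or.inl ⟨i, rfl⟩)⟩
  let w' : ι → W := fun i => ⟨e' i, Submodule.subset_span (Or.inr ⟨i, rfl⟩)⟩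
  have hw : Orthonormal 𝕜 w := (W.subtypeₗᵢ.orthonormal_comp_iff).1 he
  have hw' : Orthonormal 𝕜 w' := (W.subtypeₗᵢ.orthonormal_comp_iff).1 he'
  have hcard : Module.finrank 𝕜 W = Fintype.card ι +
      Fintype.card (Fin (Module.finrank 𝕜 W - Fintype.card ι)) := by
    have := hw.linearIndependent.fintype_card_le_finrank
    simp
    omega
  obtain ⟨b, hb⟩ := exists_orthonormalBasis_sum hcard hw
  obtain ⟨b', hb'⟩ := exists_orthonormalBasis_sum hcard hw'
  obtain ⟨U, hU⟩ := exists_unitary_extension W (b.equiv b' (Equiv.refl _))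
  refine ⟨U, fun i => ?_⟩
  have h1 := hU (w i)
  rw [← hb i, OrthonormalBasis.equiv_apply_basis, Equiv.refl_apply, hb', hb] at h1
  exact h1

/-- The operator `z ↦ ⟪y, z⟫ x` of rank at most one. -/
noncomputable def rankOneOp (x y : H) : FiniteRank 𝕜 H :=
  ⟨InnerProductSpace.rankOne 𝕜 x y, by
    have h : (InnerProductSpace.rankOne 𝕜 x y).toLinearMap.range ≤ Submodule.span 𝕜 {x} := by
      rintro _ ⟨z, rfl⟩
      exact Submodule.smul_mem _ _ (Submodule.mem_span_singleton_self x)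
    exact Submodule.finiteDimensional_of_le h⟩

/-- The operator with singular values `a`, right singular vectors `e` and left singular
vectors `f`. -/
noncomputable def diag {ι : Type*} [Fintype ι] (e f : ι → H) (a : ι → ℝ) : FiniteRank 𝕜 H :=
  ∑ i, ((a i : ℝ) : 𝕜) • rankOneOp (f i) (e i)

theorem diag_apply {ι : Type*} [Fintype ι] (e f : ι → H) (a : ι → ℝ) (x : H) :
    (diag (𝕜 := 𝕜) e f a : H →L[𝕜] H) x = ∑ i, ((a i : ℝ) : 𝕜) • inner 𝕜 (e i) x • f i := by
  simp [diag, rankOneOp]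

theorem FiniteRank.ext {A B : FiniteRank 𝕜 H}
    (h : ∀ x, (A : H →L[𝕜] H) x = (B : H →L[𝕜] H) x) : A = B :=
  Subtype.ext (ContinuousLinearMap.ext h)

theorem diag_apply_self {ι : Type*} [Fintype ι] {e : ι → H} (he : Orthonormal 𝕜 e) (f : ι → H)
    (a : ι → ℝ) (i : ι) : (diag (𝕜 := 𝕜) e f a : H →L[𝕜] H) (e i) = ((a i : ℝ) : 𝕜) • f i := by
  classical
  rw [diag_apply]
  simp [orthonormal_iff_ite.1 he]

theorem unitaryMul_diag {ι : Type*} [Fintype ι] (U V : H ≃ₗᵢ[𝕜] H) (e f : ι → H) (a : ι → ℝ) :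
    unitaryMul U (diag (𝕜 := 𝕜) e f a) V = diag (V.symm ∘ e) (U ∘ f) a := by
  refine FiniteRank.ext fun x => ?_
  change U ((diag (𝕜 := 𝕜) e f a : H →L[𝕜] H) (V x)) = _
  rw [diag_apply, diag_apply, map_sum]
  refine Finset.sum_congr rfl fun i _ => ?_
  rw [map_smul, map_smul, Function.comp, Function.comp, ← V.inner_map_map (V.symm (e i)) x,
    V.apply_symm_apply]

theorem diag_add {ι : Type*} [Fintype ι] (e f : ι → H) (a b : ι → ℝ) :
    diag (𝕜 := 𝕜) e f (a + b) = diag e f a + diag e f b := by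
  simp [diag, add_smul, Finset.sum_add_distrib]

theorem diag_smul {ι : Type*} [Fintype ι] (e f : ι → H) (c : ℝ) (a : ι → ℝ) :
    diag (𝕜 := 𝕜) e f (c • a) = ((c : ℝ) : 𝕜) • diag e f a := by
  simp [diag, mul_smul, Finset.smul_sum]

theorem diag_mul {ι : Type*} [Fintype ι] (e f : ι → H) (c a : ι → ℝ) :
    diag (𝕜 := 𝕜) e f (c * a) = diag e (fun i => ((c i : ℝ) : 𝕜) • f i) a := by
  refine FiniteRank.ext fun x => ?_
  rw [diag_apply, diag_apply]
  refine Finset.sum_congr rfl fun i _ => ?_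
  simp only [Pi.mul_apply, RCLike.ofReal_mul, smul_smul]
  congr 1
  ring

theorem diag_embed {ι κ : Type*} [Fintype ι] [Fintype κ] (g : ι ↪ κ) (e f : κ → H) (a : κ → ℝ)
    (ha : ∀ k, k ∉ Set.range g → a k = 0) :
    diag (𝕜 := 𝕜) e f a = diag (e ∘ g) (f ∘ g) (a ∘ g) :=
  (Fintype.sum_of_injective g g.injective _ _ (fun k hk => by simp [ha k hk]) fun _ => rfl).symm

theorem tensorOp_tmul (A B : H →L[𝕜] H) (x y : H) :
    tensorOp A B ((x ⊗ₜ[𝕜] y : H ⊗[𝕜] H) : HilbertTensor 𝕜 H) =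
      ((A x ⊗ₜ[𝕜] B y : H ⊗[𝕜] H) : HilbertTensor 𝕜 H) := by
  rw [tensorOp, ContinuousLinearMap.completion_apply_coe, TensorProduct.mapL_tmul]

/-- The product of two families of vectors, through `J`. -/
noncomputable def tensorFamily {ι κ : Type*} (J : HilbertTensor 𝕜 H ≃ₗᵢ[𝕜] H) (e : ι → H)
    (e' : κ → H) (x : ι × κ) : H :=
  J ((e x.1 ⊗ₜ[𝕜] e' x.2 : H ⊗[𝕜] H) : HilbertTensor 𝕜 H)

theorem orthonormal_tensorFamily {ι κ : Type*} (J : HilbertTensor 𝕜 H ≃ₗᵢ[𝕜] H) {e : ι → H}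
    {e' : κ → H} (he : Orthonormal 𝕜 e) (he' : Orthonormal 𝕜 e') :
    Orthonormal 𝕜 (tensorFamily J e e') := by
  classical
  rw [orthonormal_iff_ite] at he he' ⊢
  rintro ⟨i, k⟩ ⟨j, l⟩
  rw [tensorFamily, tensorFamily, J.inner_map_map, UniformSpace.Completion.inner_coe,
    TensorProduct.inner_tmul, he, he']
  simp only [Prod.mk.injEq]
  split_ifs <;> simp_all

theorem tensor_diag {ι κ : Type*} [Fintype ι] [Fintype κ] (J : HilbertTensor 𝕜 H ≃ₗᵢ[𝕜] H)
    (e f : ι → H) (e' f' : κ → H) (a : ι → ℝ) (b : κ → ℝ) :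
    tensor J (diag e f a) (diag e' f' b) =
      diag (tensorFamily J e e') (tensorFamily J f f') fun x => a x.1 * b x.2 := by
  refine FiniteRank.ext fun x => ?_
  obtain ⟨z, rfl⟩ := J.surjective x
  change J (tensorOp _ _ (J.symm (J z))) = _
  rw [J.symm_apply_apply]
  induction z using UniformSpace.Completion.induction_on with
  | hp => exact isClosed_eq (by fun_prop) (by fun_prop)
  | ih z =>
    induction z using TensorProduct.induction_on with
    | zero => rw [UniformSpace.Completion.coe_zero, map_zero, map_zero, map_zero]
    | add z w hz hw =>
      rw [UniformSpace.Completion.coe_add, map_add, map_add, map_add, map_add, hz, hw]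
    | tmul x y =>
      rw [tensorOp_tmul, diag_apply, diag_apply, diag_apply, TensorProduct.sum_tmul,
        Fintype.sum_prod_type]
      simp only [TensorProduct.tmul_sum, ← UniformSpace.Completion.coe_toComplL (𝕜 := 𝕜), map_sum]
      refine Finset.sum_congr rfl fun i _ => Finset.sum_congr rfl fun k _ => ?_
      simp only [UniformSpace.Completion.coe_toComplL, tensorFamily, J.inner_map_map,
        UniformSpace.Completion.inner_coe, TensorProduct.inner_tmul, smul_smul,
        TensorProduct.smul_tmul_smul, map_smul, RCLike.ofReal_mul]
      congr 1
      ring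

end

/-! ### From the operator norm axioms to a gauge -/

section Gauge

variable {𝕜 : Type*} [RCLike 𝕜] {H : Type*} [NormedAddCommGroup H] [InnerProductSpace 𝕜 H]

/-- The value of a seminorm on the diagonal operators with respect to an orthonormal sequence. -/
noncomputable def gauge (N : Seminorm 𝕜 (FiniteRank 𝕜 H)) (e : ℕ → H) (ι : Type) [Fintype ι]
    (a : ι → ℝ) : ℝ :=
  N (diag (fun i => e (Fintype.equivFin ι i)) (fun i => e (Fintype.equivFin ι i)) a)

variable {N : Seminorm 𝕜 (FiniteRank 𝕜 H)} {e : ℕ → H}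

theorem orthonormal_comp_equivFin (he : Orthonormal 𝕜 e) (ι : Type) [Fintype ι] :
    Orthonormal 𝕜 fun i : ι => e (Fintype.equivFin ι i) :=
  he.comp _ (Fin.val_injective.comp (Fintype.equivFin ι).injective)

/-- Sending `u` to the reference family on the right, and the reference family to `v` on the left,
costs nothing by unitary invariance. Hence only the singular values matter. -/
theorem gauge_eq_map_diag
    (hunit : ∀ (U V : H ≃ₗᵢ[𝕜] H) (A : FiniteRank 𝕜 H), N (unitaryMul U A V) = N A)
    (he : Orthonormal 𝕜 e) {ι : Type} [Fintype ι] {u v : ι → H} (hu : Orthonormal 𝕜 u)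
    (hv : Orthonormal 𝕜 v) (a : ι → ℝ) : gauge N e ι a = N (diag u v a) := by
  obtain ⟨V, hV⟩ := exists_unitary_map_orthonormal hu (orthonormal_comp_equivFin he ι)
  obtain ⟨U, hU⟩ := exists_unitary_map_orthonormal (orthonormal_comp_equivFin he ι) hv
  rw [gauge, ← hunit U V (diag _ _ a), unitaryMul_diag]
  congr 2
  · funext i
    simp [← hV]
  · funext i
    exact hU i

theorem isCrossGauge_gauge (hN : ∀ A : FiniteRank 𝕜 H, N A = 0 → A = 0)
    (hunit : ∀ (U V : H ≃ₗᵢ[𝕜] H) (A : FiniteRank 𝕜 H), N (unitaryMul U A V) = N A)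
    (J : HilbertTensor 𝕜 H ≃ₗᵢ[𝕜] H)
    (hmul : ∀ A B : FiniteRank 𝕜 H, N (tensor J A B) = N A * N B)
    (he : Orthonormal 𝕜 e) : IsCrossGauge (gauge N e) where
  add_le a b := by
    rw [gauge, diag_add]
    exact map_add_le_add N _ _
  smul c a := by
    rw [gauge, diag_smul, map_smul_eq_mul, RCLike.norm_ofReal]
    rfl
  sign {ι} _ ε a hε := by
    classical
    rw [gauge, diag_mul]
    -- The signs are absorbed into the left singular vectors, which remain orthonormal.
    refine (gauge_eq_map_diag hunit he (orthonormal_comp_equivFin he ι) ?_ a).symm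
    have h0 := orthonormal_iff_ite.1 (orthonormal_comp_equivFin he ι)
    rw [orthonormal_iff_ite]
    intro i j
    rw [inner_smul_left, inner_smul_right, h0]
    split_ifs with hij
    · subst hij
      rcases hε i with hi | hi <;> simp [hi]
    · simp
  embed {ι κ} _ _ g a ha := by
    rw [gauge, diag_embed g _ _ _ ha]
    exact (gauge_eq_map_diag hunit he ((orthonormal_comp_equivFin he κ).comp _ g.injective)
      ((orthonormal_comp_equivFin he κ).comp _ g.injective) _).symm
  tensor {ι κ} _ _ a b := by
    have h := orthonormal_tensorFamily J (orthonormal_comp_equivFin he ι)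
      (orthonormal_comp_equivFin he κ)
    rw [gauge_eq_map_diag hunit he h h, ← tensor_diag, hmul]
    rfl
  unit_ne_zero h := by
    have h1 := hN _ h
    have h2 := diag_apply_self (orthonormal_comp_equivFin he Unit)
      (fun i => e (Fintype.equivFin Unit i)) 1 ()
    rw [h1] at h2
    have h3 := (orthonormal_comp_equivFin he Unit).ne_zero ()
    simp at h2
    exact h3 (by simpa using h2.symm)

end Gauge

/-! ### Schatten norms of diagonal operators and singular values -/

section

variable {𝕜 : Type*} [RCLike 𝕜] {H : Type*} [NormedAddCommGroup H] [InnerProductSpace 𝕜 H]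

theorem inner_diag_apply {ι : Type*} [Fintype ι] {f : ι → H} (hf : Orthonormal 𝕜 f) (e : ι → H)
    (a : ι → ℝ) (x : H) (i : ι) :
    inner 𝕜 (f i) ((diag (𝕜 := 𝕜) e f a : H →L[𝕜] H) x) = ((a i : ℝ) : 𝕜) * inner 𝕜 (e i) x := by
  rw [diag_apply]
  simp only [smul_smul]
  exact hf.inner_right_fintype _ i

/-- As the coefficients are nonzero, `e` is an orthonormal basis of the range, on which the trace is
computed. -/
theorem opTrace_diag {ι : Type*} [Fintype ι] {e : ι → H} (he : Orthonormal 𝕜 e) (a : ι → ℝ)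
    (ha : ∀ i, a i ≠ 0) :
    opTrace (diag (𝕜 := 𝕜) e e a : H →L[𝕜] H) = ∑ i, ((a i : ℝ) : 𝕜) := by
  set T : H →L[𝕜] H := (diag (𝕜 := 𝕜) e e a : H →L[𝕜] H) with hT
  have hmem : ∀ i, e i ∈ T.toLinearMap.range := fun i => by
    refine ⟨((a i : ℝ) : 𝕜)⁻¹ • e i, ?_⟩
    rw [map_smul]
    change _ • T (e i) = e i
    rw [hT, diag_apply_self he, inv_smul_smul₀]
    exact_mod_cast ha i
  let v : ι → T.toLinearMap.range := fun i => ⟨e i, hmem i⟩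
  have hv : Orthonormal 𝕜 v := (T.toLinearMap.range.subtypeₗᵢ.orthonormal_comp_iff).1 he
  have hspan : ⊤ ≤ Submodule.span 𝕜 (Set.range v) := by
    rintro ⟨_, x, rfl⟩ -
    have : (⟨T.toLinearMap x, x, rfl⟩ : T.toLinearMap.range) =
        ∑ i, (((a i : ℝ) : 𝕜) * inner 𝕜 (e i) x) • v i := by
      apply Subtype.ext
      refine (diag_apply e e a x).trans ?_
      simp [v, smul_smul]
    rw [this]
    exact Submodule.sum_mem _ fun i _ =>
      Submodule.smul_mem _ _ (Submodule.subset_span ⟨i, rfl⟩)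
  rw [opTrace, LinearMap.trace_eq_sum_inner _ (OrthonormalBasis.mk hv hspan)]
  refine Finset.sum_congr rfl fun i _ => ?_
  rw [OrthonormalBasis.coe_mk]
  change inner 𝕜 (e i) (T (e i)) = _
  rw [hT, inner_diag_apply he, inner_self_eq_norm_sq_to_K, he.1 i]
  simp

theorem norm_diag {ι : Type*} [Fintype ι] {e f : ι → H} (he : Orthonormal 𝕜 e)
    (hf : Orthonormal 𝕜 f) (a : ι → ℝ) (ha : ∀ i, 0 ≤ a i) :
    ‖(diag (𝕜 := 𝕜) e f a : H →L[𝕜] H)‖ = ⨆ i, a i := by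
  have hM : 0 ≤ ⨆ i, a i := Real.iSup_nonneg ha
  have hle : ∀ i, a i ≤ ⨆ i, a i := le_ciSup (Set.finite_range a).bddAbove
  apply le_antisymm
  · refine ContinuousLinearMap.opNorm_le_bound _ hM fun x => ?_
    rw [← sq_le_sq₀ (norm_nonneg _) (by positivity), diag_apply]
    simp only [smul_smul]
    have hsum : ‖∑ i, (((a i : ℝ) : 𝕜) * inner 𝕜 (e i) x) • f i‖ ^ 2 =
        ∑ i, ‖((a i : ℝ) : 𝕜) * inner 𝕜 (e i) x‖ ^ 2 := by
      have h := hf.inner_sum (fun i => ((a i : ℝ) : 𝕜) * inner 𝕜 (e i) x)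
        (fun i => ((a i : ℝ) : 𝕜) * inner 𝕜 (e i) x) Finset.univ
      simp only [inner_self_eq_norm_sq_to_K, RCLike.conj_mul] at h
      exact_mod_cast h
    rw [hsum, mul_pow]
    refine le_trans ?_ (mul_le_mul_of_nonneg_left (he.sum_inner_products_le x (s := Finset.univ))
      (sq_nonneg _))
    rw [Finset.mul_sum]
    refine Finset.sum_le_sum fun i _ => ?_
    rw [norm_mul, mul_pow, RCLike.norm_ofReal, abs_of_nonneg (ha i)]
    exact mul_le_mul_of_nonneg_right (pow_le_pow_left₀ (ha i) (hle i) 2) (sq_nonneg _)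
  · refine Real.iSup_le (fun i => ?_) (norm_nonneg _)
    have h := (diag (𝕜 := 𝕜) e f a : H →L[𝕜] H).le_opNorm (e i)
    rwa [diag_apply_self he, norm_smul, he.1 i, hf.1 i, mul_one, mul_one, RCLike.norm_ofReal,
      abs_of_nonneg (ha i)] at h

variable [CompleteSpace H]

theorem adjoint_diag_apply {ι : Type*} [Fintype ι] (e f : ι → H) (a : ι → ℝ) (x : H) :
    ((diag (𝕜 := 𝕜) e f a : H →L[𝕜] H)†) x = (diag (𝕜 := 𝕜) f e a : H →L[𝕜] H) x := by
  refine ext_inner_right 𝕜 fun y => ?_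
  rw [ContinuousLinearMap.adjoint_inner_left, diag_apply, diag_apply, inner_sum, sum_inner]
  refine Finset.sum_congr rfl fun i _ => ?_
  simp only [inner_smul_left, inner_smul_right, RCLike.conj_ofReal, inner_conj_symm]
  ring

theorem absSpectralProj_diag {ι : Type*} [Fintype ι] {e f : ι → H} (he : Orthonormal 𝕜 e)
    (hf : Orthonormal 𝕜 f) (a : ι → ℝ) (ha : ∀ i, 0 < a i) {s : ℝ} (hs : 0 < s) :
    absSpectralProj (diag (𝕜 := 𝕜) e f a : H →L[𝕜] H) s =
      (diag (𝕜 := 𝕜) e e fun i => if a i = s then 1 else 0 : H →L[𝕜] H) := by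
  classical
  ext x
  rw [absSpectralProj]
  set A : H →L[𝕜] H := (diag (𝕜 := 𝕜) e f a : H →L[𝕜] H) with hA
  have hker : ∀ w : H, w ∈ ((A† ∘L A) - ((s ^ 2 : ℝ) : 𝕜) • ContinuousLinearMap.id 𝕜 H).ker ↔
      (diag (𝕜 := 𝕜) e e (fun i => a i ^ 2) : H →L[𝕜] H) w = ((s ^ 2 : ℝ) : 𝕜) • w := by
    intro w
    have h1 : (A† ∘L A) w = (diag (𝕜 := 𝕜) e e (fun i => a i ^ 2) : H →L[𝕜] H) w := by
      rw [ContinuousLinearMap.comp_apply, hA, adjoint_diag_apply, diag_apply f e, diag_apply e e]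
      refine Finset.sum_congr rfl fun i _ => ?_
      rw [inner_diag_apply hf]
      simp only [smul_smul]
      congr 1
      push_cast
      ring
    rw [LinearMap.mem_ker, ← h1, ← sub_eq_zero (a := (A† ∘L A) w)]
    rfl
  have hs' : ((s ^ 2 : ℝ) : 𝕜) ≠ 0 := by
    exact_mod_cast (pow_pos hs 2).ne'
  refine Submodule.eq_starProjection_of_mem_of_inner_eq_zero ?_ fun w hw => ?_
  · rw [hker, diag_apply, diag_apply, Finset.smul_sum]
    refine Finset.sum_congr rfl fun i _ => ?_
    rw [← diag_apply, inner_diag_apply he]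
    by_cases hi : a i = s
    · simp [hi]
    · simp [hi]
  · rw [hker] at hw
    have h0 : ∀ i, a i ≠ s → inner 𝕜 (e i) w = 0 := by
      intro i hi
      have h1 := congrArg (inner 𝕜 (e i)) hw
      rw [inner_diag_apply he, inner_smul_right, ← sub_eq_zero, ← sub_mul] at h1
      refine (mul_eq_zero.1 h1).resolve_left fun h2 => hi ?_
      exact (sq_eq_sq₀ (ha i).le hs.le).1 (by exact_mod_cast sub_eq_zero.1 h2)
    -- Because `s ≠ 0`, an eigenvector lies in the range of `A† A`, hence in the span of the `e i`,
    -- so orthogonality can be tested on the `e i` with `a i = s`.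
    have hw' : w = ((s ^ 2 : ℝ) : 𝕜)⁻¹ • (diag (𝕜 := 𝕜) e e (fun i => a i ^ 2) : H →L[𝕜] H) w := by
      rw [hw, inv_smul_smul₀ hs']
    rw [hw', inner_smul_right, diag_apply e e fun i => a i ^ 2, inner_sum]
    refine mul_eq_zero_of_right _ (Finset.sum_eq_zero fun i _ => ?_)
    rw [inner_smul_right, inner_smul_right]
    by_cases hi : a i = s
    · have h3 : inner 𝕜 (x - (diag (𝕜 := 𝕜) e e (fun i => if a i = s then 1 else 0) :
          H →L[𝕜] H) x) (e i) = 0 := by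
        rw [← inner_conj_symm, inner_sub_right, inner_diag_apply he]
        simp [hi]
      rw [h3, mul_zero, mul_zero]
    · rw [h0 i hi, zero_mul, mul_zero]

theorem absPow_diag {ι : Type*} [Fintype ι] {e f : ι → H} (he : Orthonormal 𝕜 e)
    (hf : Orthonormal 𝕜 f) (a : ι → ℝ) (ha : ∀ i, 0 < a i) (p : ℝ) :
    absPow (diag (𝕜 := 𝕜) e f a : H →L[𝕜] H) p =
      (diag (𝕜 := 𝕜) e e fun i => a i ^ p : H →L[𝕜] H) := by
  classical
  have h1 : absPow (diag (𝕜 := 𝕜) e f a : H →L[𝕜] H) p =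
      ∑ᶠ s ∈ Set.Ioi (0 : ℝ), ((s ^ p : ℝ) : 𝕜) •
        (diag (𝕜 := 𝕜) e e fun i => if a i = s then 1 else 0 : H →L[𝕜] H) :=
    finsum_mem_congr rfl fun s hs => by rw [absSpectralProj_diag he hf a ha hs]
  have h2 : Set.Ioi (0 : ℝ) ∩ Function.support (fun s : ℝ => ((s ^ p : ℝ) : 𝕜) •
        (diag (𝕜 := 𝕜) e e fun i => if a i = s then 1 else 0 : H →L[𝕜] H)) =
      ↑(Finset.univ.image a) ∩ Function.support (fun s : ℝ => ((s ^ p : ℝ) : 𝕜) •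
        (diag (𝕜 := 𝕜) e e fun i => if a i = s then 1 else 0 : H →L[𝕜] H)) := by
    ext s
    refine and_congr_left fun hs => ⟨fun _ => ?_, fun h => ?_⟩
    · by_contra hne
      refine hs ?_
      have : (fun i => if a i = s then (1 : ℝ) else 0) = 0 := by
        funext i
        refine if_neg fun hi => hne ?_
        simp [← hi]
      dsimp only
      rw [this]
      simp [diag]
    · obtain ⟨i, -, rfl⟩ := Finset.mem_image.1 (Finset.mem_coe.1 h)
      exact ha i
  rw [h1, finsum_mem_eq_sum_of_inter_support_eq _ h2]
  ext x
  rw [sum_apply, diag_apply]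
  simp only [smul_apply, diag_apply, Finset.smul_sum]
  rw [Finset.sum_comm]
  refine Finset.sum_congr rfl fun i _ => ?_
  rw [Finset.sum_eq_single (a i)]
  · simp
  · intro s _ hs
    simp [hs.symm]
  · intro h
    simp at h

theorem schattenNorm_diag {ι : Type*} [Fintype ι] {e f : ι → H} (he : Orthonormal 𝕜 e)
    (hf : Orthonormal 𝕜 f) (a : ι → ℝ) (ha : ∀ i, 0 < a i) {p : ℝ≥0∞} (hp : p ≠ ∞) :
    schattenNorm p (diag (𝕜 := 𝕜) e f a : H →L[𝕜] H) =
      (∑ i, a i ^ p.toReal) ^ (1 / p.toReal) := by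
  rw [schattenNorm, if_neg hp, absPow_diag he hf a ha,
    opTrace_diag he _ fun i => (Real.rpow_pos_of_pos (ha i) _).ne', map_sum]
  simp only [RCLike.ofReal_re]

/-- The singular value decomposition of a finite-rank operator. -/
theorem exists_eq_diag (A : FiniteRank 𝕜 H) :
    ∃ (n : ℕ) (e f : Fin n → H) (a : Fin n → ℝ), Orthonormal 𝕜 e ∧ Orthonormal 𝕜 f ∧
      (∀ i, 0 < a i) ∧ A = diag e f a := by
  obtain ⟨A, hA⟩ := A
  have hfin : FiniteDimensional 𝕜 A.toLinearMap.range := hA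
  -- This finite-dimensional space is orthogonal to `ker A`, so `A† A` restricts to it with strictly
  -- positive eigenvalues.
  let V : Submodule 𝕜 H := A.toLinearMap.range.map (A†).toLinearMap
  have hT : ∀ x ∈ V, (A† ∘L A).toLinearMap x ∈ V := fun x _ => ⟨A x, ⟨x, rfl⟩, rfl⟩
  let T : V →ₗ[𝕜] V := (A† ∘L A).toLinearMap.restrict hT
  have hadj : ∀ x y : H, inner 𝕜 ((A†) (A x)) y = inner 𝕜 (A x) (A y) := fun x y =>
    ContinuousLinearMap.adjoint_inner_left A y (A x)
  have hsymm : T.IsSymmetric := fun x y => by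
    change inner 𝕜 ((A†) (A (x : H))) (y : H) = inner 𝕜 (x : H) ((A†) (A (y : H)))
    rw [hadj, ContinuousLinearMap.adjoint_inner_right]
  let b := hsymm.eigenvectorBasis rfl
  let μ := hsymm.eigenvalues rfl
  have hb : ∀ i, (A†) (A (b i : H)) = ((μ i : ℝ) : 𝕜) • (b i : H) := fun i =>
    congrArg Subtype.val (hsymm.apply_eigenvectorBasis rfl i)
  have horth : Orthonormal 𝕜 fun i => (b i : H) :=
    V.subtypeₗᵢ.orthonormal_comp_iff.2 b.orthonormal
  have hinner : ∀ i j, inner 𝕜 (A (b i : H)) (A (b j : H)) =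
      if i = j then ((μ i : ℝ) : 𝕜) else 0 := fun i j => by
    rw [← hadj, hb, inner_smul_left, orthonormal_iff_ite.1 horth]
    split_ifs <;> simp
  have hnorm : ∀ i, ‖A (b i : H)‖ ^ 2 = μ i := fun i => by
    have := hinner i i
    rw [inner_self_eq_norm_sq_to_K, if_pos rfl] at this
    exact_mod_cast this
  have hμ : ∀ i, 0 < μ i := fun i => by
    refine lt_of_le_of_ne ((hnorm i) ▸ sq_nonneg _) fun h0 => ?_
    have hA0 : A (b i : H) = 0 := by
      rw [← norm_eq_zero, ← sq_eq_zero_iff, hnorm, ← h0]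
    obtain ⟨_, ⟨x, rfl⟩, hx⟩ := (b i).2
    have h1 : inner 𝕜 (b i : H) (b i : H) = (0 : 𝕜) := by
      nth_rw 1 [← hx]
      change inner 𝕜 ((A†) (A x)) (b i : H) = 0
      rw [hadj, hA0, inner_zero_right]
    exact horth.ne_zero i (inner_self_eq_zero.1 h1)
  have hsq : ∀ i, ((√(μ i) : ℝ) : 𝕜) ≠ 0 := fun i => by
    exact_mod_cast (Real.sqrt_pos.2 (hμ i)).ne'
  refine ⟨_, fun i => (b i : H), fun i => ((√(μ i) : ℝ) : 𝕜)⁻¹ • A (b i : H), fun i => √(μ i),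
    horth, ?_, fun i => Real.sqrt_pos.2 (hμ i), FiniteRank.ext fun x => ?_⟩
  · rw [orthonormal_iff_ite]
    intro i j
    rw [inner_smul_left, inner_smul_right, hinner]
    split_ifs with hij
    · subst hij
      rw [← RCLike.ofReal_inv, RCLike.conj_ofReal, ← RCLike.ofReal_mul, ← RCLike.ofReal_mul,
        ← mul_assoc, ← mul_inv, Real.mul_self_sqrt (hμ i).le, inv_mul_cancel₀ (hμ i).ne',
        RCLike.ofReal_one]
    · simp
  · rw [diag_apply]
    -- With `y` the component of `x` orthogonal to `V`, `A† A y` lies in `V`, so `⟪A y, A y⟫ = ⟪y,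
    -- A† A y⟫ = 0`.
    have hproj : A (x - V.starProjection x) = 0 := by
      have h1 : inner 𝕜 (x - V.starProjection x) ((A†) (A (x - V.starProjection x))) = (0 : 𝕜) :=
        Submodule.starProjection_inner_eq_zero _ _ ⟨_, ⟨_, rfl⟩, rfl⟩
      rw [ContinuousLinearMap.adjoint_inner_right] at h1
      exact inner_self_eq_zero.1 h1
    rw [map_sub, sub_eq_zero] at hproj
    change A x = _
    rw [hproj, b.starProjection_eq_sum_rankOne, sum_apply, map_sum]
    refine Finset.sum_congr rfl fun i _ => ?_
    rw [InnerProductSpace.rankOne_apply, map_smul, smul_comm (inner 𝕜 (b i : H) x),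
      smul_inv_smul₀ (hsq i)]

end

end SchattenChar

theorem theorem4 {𝕜 : Type*} [RCLike 𝕜] {H : Type*} [NormedAddCommGroup H]
    [InnerProductSpace 𝕜 H] [CompleteSpace H] (hH : ¬ FiniteDimensional 𝕜 H)
    (J : SchattenChar.HilbertTensor 𝕜 H ≃ₗᵢ[𝕜] H)
    (N : Seminorm 𝕜 (SchattenChar.FiniteRank 𝕜 H))
    (hN : ∀ A : SchattenChar.FiniteRank 𝕜 H, N A = 0 → A = 0)
    (hunit : ∀ (U V : H ≃ₗᵢ[𝕜] H) (A : SchattenChar.FiniteRank 𝕜 H),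
      N (SchattenChar.unitaryMul U A V) = N A)
    (hmul : ∀ A B : SchattenChar.FiniteRank 𝕜 H,
      N (SchattenChar.tensor J A B) = N A * N B) :
    ∃ p : ℝ≥0∞, 1 ≤ p ∧
      ∀ A : SchattenChar.FiniteRank 𝕜 H, N A = SchattenChar.schattenNorm p (A : H →L[𝕜] H) := by
  obtain ⟨e, he⟩ := SchattenChar.exists_orthonormal_nat hH
  have h := SchattenChar.isCrossGauge_gauge hN hunit J hmul he
  obtain ⟨α, hα0, hα1, hα⟩ := h.exists_exponent
  rcases hα0.eq_or_lt with rfl | hα0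
  · refine ⟨∞, le_top, fun A => ?_⟩
    obtain ⟨n, u, v, a, hu, hv, ha, rfl⟩ := SchattenChar.exists_eq_diag A
    rw [SchattenChar.schattenNorm, if_pos rfl, SchattenChar.norm_diag hu hv a fun i => (ha i).le,
      ← SchattenChar.gauge_eq_map_diag hunit he hu hv,
      h.eq_iSup (fun n hn => by simpa using hα n hn) a ha]
  · refine ⟨ENNReal.ofReal α⁻¹, ?_, fun A => ?_⟩
    · rw [← ENNReal.ofReal_one]
      exact ENNReal.ofReal_le_ofReal ((one_le_inv₀ hα0).2 hα1)
    · obtain ⟨n, u, v, a, hu, hv, ha, rfl⟩ := SchattenChar.exists_eq_diag A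
      rw [SchattenChar.schattenNorm_diag hu hv a ha ENNReal.ofReal_ne_top,
        ENNReal.toReal_ofReal (inv_nonneg.2 hα0.le), one_div, inv_inv,
        ← SchattenChar.gauge_eq_map_diag hunit he hu hv, h.eq_rpow_sum hα0 hα1 hα a ha]
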